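/- For $n\ge 2$ let $G=\mathbb{Z}^n\rtimes\big((\mathbb{Z}/2)^n\rtimes S_n\big)$, where the $i$-th factor of $(\mathbb{Z}/2)^n$ acts on $\mathbb{Z}^n$ by $x\mapsto -x$ in the $i$-th coordinate (and trivially on the other coordinates), and $S_n$ acts on $(\mathbb{Z}/2)^n$ and on $\mathbb{Z}^n$ by permuting the standard bases. A group has property $\mathcal{FA}_d$ if each of its isometric actions on a (nonempty) complete $\mathrm{CAT}(0)$ space of covering dimension $d$ has a global fixed point. Then every isometric action of $G$ on a complete $\mathrm{CAT}(0)$ space of covering dimension $d<n$ has a global fixed point; in particular $G$ has property $\mathcal{FA}_{n-1}$. The bound is sharp: $G$ does not have property $\mathcal{FA}_n$, that is, $G$ has an isometric action without a global fixed point on some complete $\mathrm{CAT}(0)$ space of covering dimension $n$. -/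

import Mathlib

universe u

/-- `γ`, restricted to `[0, 1]`, is a (linearly parametrized) geodesic from `x` to `y`. -/
def IsGeodesicPath {X : Type u} [MetricSpace X] (γ : ℝ → X) (x y : X) : Prop :=
  γ 0 = x ∧ γ 1 = y ∧
    ∀ s ∈ Set.Icc (0 : ℝ) 1, ∀ t ∈ Set.Icc (0 : ℝ) 1, dist (γ s) (γ t) = |s - t| * dist x y

/-- A `CAT(0)` space: a (nonempty) geodesic metric space all of whose geodesic triangles are no
fatter than their Euclidean comparison triangles. Two points of a triangle on different sides lie
on the two sides issuing from a common vertex, called `x` here; for two points on the same side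
the comparison inequality is an equality. -/
structure IsCAT0 (X : Type u) [MetricSpace X] : Prop where
  nonempty : Nonempty X
  geodesic : ∀ x y : X, ∃ γ : ℝ → X, IsGeodesicPath γ x y
  comparison : ∀ (x y z : X) (α β : ℝ → X), IsGeodesicPath α x y → IsGeodesicPath β x z →
    ∀ x' y' z' : EuclideanSpace ℝ (Fin 2),
      dist x' y' = dist x y → dist y' z' = dist y z → dist x' z' = dist x z →
      ∀ s ∈ Set.Icc (0 : ℝ) 1, ∀ t ∈ Set.Icc (0 : ℝ) 1,
        dist (α s) (β t) ≤ dist (AffineMap.lineMap x' y' s) (AffineMap.lineMap x' z' t)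

/-- The covering dimension of `X` is at most `d`: every open cover has an open refinement such
that no point lies in more than `d + 1` of its members. -/
def CoveringDimLE (X : Type u) [TopologicalSpace X] (d : ℕ) : Prop :=
  ∀ U : Set (Set X), (∀ A ∈ U, IsOpen A) → ⋃₀ U = Set.univ →
    ∃ V : Set (Set X), (∀ B ∈ V, IsOpen B) ∧ ⋃₀ V = Set.univ ∧ (∀ B ∈ V, ∃ A ∈ U, B ⊆ A) ∧
      ∀ x : X, {B ∈ V | x ∈ B}.encard ≤ (d : ℕ∞) + 1

/-- The covering dimension of `X` is exactly `d`. -/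
def HasCoveringDim (X : Type u) [TopologicalSpace X] (d : ℕ) : Prop :=
  IsLeast {k : ℕ | CoveringDimLE X k} d

/-- Property `FA_d`: every isometric action of `G` on a complete `CAT(0)` space of dimension `d`
has a global fixed point. -/
def PropertyFA (G : Type) [Group G] (d : ℕ) : Prop :=
  ∀ (X : Type u) [MetricSpace X] [CompleteSpace X] [MulAction G X] [IsIsometricSMul G X],
    IsCAT0 X → HasCoveringDim X d → ∃ x : X, ∀ g : G, g • x = x

/-- The isomorphism of `ℤ/2` with `{1, -1}`. -/
def zmodTwoSign : Multiplicative (ZMod 2) →* ℤˣ where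
  toFun e := (-1 : ℤˣ) ^ e.toAdd
  map_one' := by simp
  map_mul' a b := by simp [uzpow_add]

/-- `(ℤ/2)^n ⋊ S_n`, with `S_n` permuting the standard basis. -/
abbrev SignedPerm (n : ℕ) : Type :=
  (Fin n → Multiplicative (ZMod 2)) ⋊[mulAutArrow] Equiv.Perm (Fin n)

/-- `(ℤ/2)^n` acting on `ℤ^n` (written multiplicatively) by coordinate reflections. -/
def reflectionHom (n : ℕ) :
    (Fin n → Multiplicative (ZMod 2)) →* MulAut (Fin n → Multiplicative ℤ) where
  toFun e :=
    { toFun := fun x i => x i ^ ((zmodTwoSign (e i) : ℤˣ) : ℤ)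
      invFun := fun x i => x i ^ ((zmodTwoSign (e i) : ℤˣ) : ℤ)
      left_inv := fun x => by
        funext i
        beta_reduce
        rw [← zpow_mul, ← Units.val_mul, Int.units_mul_self, Units.val_one, zpow_one]
      right_inv := fun x => by
        funext i
        beta_reduce
        rw [← zpow_mul, ← Units.val_mul, Int.units_mul_self, Units.val_one, zpow_one]
      map_mul' := fun x y => by
        funext i
        exact mul_zpow _ _ _ }
  map_one' := by
    ext x i
    simp
  map_mul' a b := by
    ext1 x
    funext i
    change x i ^ ((zmodTwoSign (a i * b i) : ℤˣ) : ℤ) =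
      (x i ^ ((zmodTwoSign (b i) : ℤˣ) : ℤ)) ^ ((zmodTwoSign (a i) : ℤˣ) : ℤ)
    rw [← zpow_mul, map_mul, Units.val_mul, mul_comm]

/-- `(ℤ/2)^n ⋊ S_n` acting on `ℤ^n` by coordinate reflections and permutations of the standard
basis. -/
def signedPermHom (n : ℕ) : SignedPerm n →* MulAut (Fin n → Multiplicative ℤ) :=
  SemidirectProduct.lift (reflectionHom n) mulAutArrow (fun g => by
    ext1 e
    ext1 x
    funext i
    change x i ^ ((zmodTwoSign (e (g⁻¹ • i)) : ℤˣ) : ℤ) =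
      x (g⁻¹⁻¹ • g⁻¹ • i) ^ ((zmodTwoSign (e (g⁻¹ • i)) : ℤˣ) : ℤ)
    rw [inv_smul_smul])

/-- `ℤ^n ⋊ ((ℤ/2)^n ⋊ S_n)`. -/
abbrev AffineSignedPerm (n : ℕ) : Type :=
  (Fin n → Multiplicative ℤ) ⋊[signedPermHom n] SignedPerm n

/-! The group acts on `ℝ^n` as the affine reflection group whose alcove is the simplex `1/2 ≥ x_0 ≥
… ≥ x_{n-1} ≥ 0`. It is generated by the `n + 1` reflections in the walls, and any `n` of these fix
the opposite vertex, hence lie in a finite stabilizer.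

Let the group act on a complete `CAT(0)` space of covering dimension `d < n`. By Bruhat–Tits each
finite stabilizer has a fixed point, so the `n + 1` fixed sets of the generators are closed convex
sets any `n` of which meet. A Helly theorem (`IsCAT0.helly`) makes them all meet, and a common point
is fixed by the whole group. For Helly: if the sets had no common point, their complements would
form an open cover with a refinement of multiplicity at most `d + 1 ≤ n`. Pulling it back to the
cube `[0,1]^n` along an iterated geodesic cone over the given points gives a cover obeying Kuhn's
boundary conditions. By the cubical Sperner lemma some point then lies in `n + 1` distinct members,
a contradiction.

For sharpness the action on `ℝ^n` is used: translations leave no fixed point. That `ℝ^n` has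
covering dimension at most `n` is shown directly; that it is not smaller follows from the fixed
point theorem itself. -/

/-! ### Kuhn's cubical Sperner lemma. -/

open Finset in
/-- Among the facets of a simplex whose vertices are labelled by `0, …, n`, the number of those
carrying all the labels `0, …, n - 1` is odd exactly when the simplex carries all labels. -/
theorem sum_facets_full_eq (n : ℕ) (l : ℕ → ℕ) (hl : ∀ k ≤ n, l k ≤ n) :
    open Classical in
    (∑ k ∈ range (n + 1), if ∀ c < n, ∃ k' ≤ n, k' ≠ k ∧ l k' = c then (1 : ZMod 2) else 0) =
      if ∀ c ≤ n, ∃ k ≤ n, l k = c then 1 else 0 := by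
  classical
  by_cases hr : ∀ c ≤ n, ∃ k ≤ n, l k = c
  · rw [if_pos hr]
    have hinj : Set.InjOn l (range (n + 1)) := by
      have hsurj : Set.SurjOn l (range (n + 1)) (range (n + 1)) := by
        intro c hc
        obtain ⟨k, hk, rfl⟩ := hr c (by simpa [Nat.lt_succ_iff] using hc)
        exact ⟨k, by simpa [Nat.lt_succ_iff] using hk, rfl⟩
      exact injOn_of_surjOn_of_card_le l
        (fun k hk => by
          have := hl k (by simpa [Nat.lt_succ_iff] using hk)
          simpa [Nat.lt_succ_iff] using this) hsurj le_rfl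
    -- The labelling is now bijective, so only the facet opposite the vertex labelled `n` counts.
    obtain ⟨k₀, hk₀, hk₀n⟩ := hr n le_rfl
    have key : ∀ k ∈ range (n + 1),
        (if ∀ c < n, ∃ k' ≤ n, k' ≠ k ∧ l k' = c then (1 : ZMod 2) else 0) =
          if k = k₀ then 1 else 0 := by
      intro k hk
      refine if_congr ⟨fun h => ?_, ?_⟩ rfl rfl
      · by_contra hne
        have hkn : l k ≠ n := fun e =>
          hne (hinj hk (by simpa [Nat.lt_succ_iff] using hk₀) (e.trans hk₀n.symm))
        have hk' : k ≤ n := by simpa [Nat.lt_succ_iff] using hk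
        obtain ⟨k', hk'n, hne', he⟩ := h (l k) (lt_of_le_of_ne (hl k hk') hkn)
        exact hne' (hinj (by simpa [Nat.lt_succ_iff] using hk'n) hk he)
      · rintro rfl c hc
        obtain ⟨k', hk', rfl⟩ := hr c hc.le
        exact ⟨k', hk', fun e => by subst e; omega, rfl⟩
    rw [sum_congr rfl key, sum_ite_eq', if_pos (by simpa [Nat.lt_succ_iff] using hk₀)]
  · rw [if_neg hr]
    by_cases hd : ∃ k₀ ≤ n, ∀ c < n, ∃ k' ≤ n, k' ≠ k₀ ∧ l k' = c
    · obtain ⟨k₀, hk₀, hd⟩ := hd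
      -- A full facet without a full simplex means that label `n` is absent; then exactly one label
      -- is repeated, at `k₀` and `k₁`, and the full facets are those opposite these two vertices.
      have hlt : ∀ k ≤ n, l k < n := by
        intro k hk
        refine lt_of_le_of_ne (hl k hk) fun e => hr fun c hc => ?_
        rcases hc.lt_or_eq with hc | rfl
        · obtain ⟨k', h1, -, h2⟩ := hd c hc
          exact ⟨k', h1, h2⟩
        · exact ⟨k, hk, e⟩
      have hinj : Set.InjOn l ((range (n + 1)).erase k₀) := by
        have hsurj : Set.SurjOn l ((range (n + 1)).erase k₀) (range n) := by
          intro c hc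
          obtain ⟨k, hk, hne, rfl⟩ := hd c (by simpa using hc)
          exact ⟨k, by simpa [Nat.lt_succ_iff] using ⟨hk, hne⟩, rfl⟩
        refine injOn_of_surjOn_of_card_le l (fun k hk => ?_) hsurj ?_
        · have hk' : k ≤ n ∧ k ≠ k₀ := by simpa [Nat.lt_succ_iff] using hk
          simpa using hlt k hk'.1
        · rw [card_erase_of_mem (by simpa [Nat.lt_succ_iff] using hk₀)]
          simp
      have hinj' : ∀ a ≤ n, a ≠ k₀ → ∀ b ≤ n, b ≠ k₀ → l a = l b → a = b := by
        intro a ha ha' b hb hb' e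
        exact hinj (by simpa [Nat.lt_succ_iff] using ⟨ha, ha'⟩)
          (by simpa [Nat.lt_succ_iff] using ⟨hb, hb'⟩) e
      obtain ⟨k₁, hk₁, hne, he⟩ := hd (l k₀) (hlt k₀ hk₀)
      have hset : ((range (n + 1)).filter fun k => ∀ c < n, ∃ k' ≤ n, k' ≠ k ∧ l k' = c) =
          {k₀, k₁} := by
        ext k
        simp only [mem_filter, mem_range, Nat.lt_succ_iff, mem_insert, mem_singleton]
        constructor
        · rintro ⟨hk, h⟩
          by_contra! hcon
          obtain ⟨k', hk', hne', he'⟩ := h (l k) (hlt k hk)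
          by_cases h0 : k' = k₀
          · subst h0
            exact hcon.2 (hinj' k hk hcon.1 k₁ hk₁ hne (he'.symm.trans he.symm))
          · exact hne' (hinj' k' hk' h0 k hk hcon.1 he')
        · rintro (rfl | rfl)
          · exact ⟨hk₀, hd⟩
          · refine ⟨hk₁, fun c hc => ?_⟩
            obtain ⟨k', hk', hne', rfl⟩ := hd c hc
            by_cases h1 : k' = k
            · exact ⟨k₀, hk₀, hne.symm, by rw [h1, he]⟩
            · exact ⟨k', hk', h1, rfl⟩
      rw [sum_boole, hset, card_pair hne.symm]
      rfl
    · push Not at hd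
      refine sum_eq_zero fun k hk => if_neg ?_
      push Not
      exact hd k (by simpa [Nat.lt_succ_iff] using hk)

/-- The `k`-th vertex of the simplex with base point `v` and edge order `σ⁻¹` in the Freudenthal
triangulation of the integer lattice. -/
def freudenthalVertex {n : ℕ} (v : Fin n → ℕ) (σ : Equiv.Perm (Fin n)) (k : ℕ) : Fin n → ℕ :=
  fun j => v j + if (σ j : ℕ) < k then 1 else 0

/-- The facet of a simplex opposite to its `k`-th vertex carries all labels below `n`. -/
def FacetFull {n : ℕ} (lam : (Fin n → ℕ) → ℕ) (v : Fin n → ℕ) (σ : Equiv.Perm (Fin n)) (k : ℕ) :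
    Prop :=
  ∀ c < n, ∃ k' ≤ n, k' ≠ k ∧ lam (freudenthalVertex v σ k') = c

/-- A simplex carries all labels up to `n`. -/
def SimplexFull {n : ℕ} (lam : (Fin n → ℕ) → ℕ) (v : Fin n → ℕ) (σ : Equiv.Perm (Fin n)) : Prop :=
  ∀ c ≤ n, ∃ k ≤ n, lam (freudenthalVertex v σ k) = c

theorem facetFull_congr {n : ℕ} {lam : (Fin n → ℕ) → ℕ} {v : Fin n → ℕ}
    {σ τ : Equiv.Perm (Fin n)} {k : ℕ}
    (h : ∀ k' ≤ n, k' ≠ k → freudenthalVertex v σ k' = freudenthalVertex v τ k') :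
    FacetFull lam v σ k ↔ FacetFull lam v τ k := by
  refine forall₂_congr fun c _ => exists_congr fun k' => ?_
  constructor <;> rintro ⟨h1, h2, h3⟩ <;> refine ⟨h1, h2, ?_⟩
  · rw [← h k' h1 h2, h3]
  · rw [h k' h1 h2, h3]

/-- The two simplices sharing a facet opposite to a middle vertex cancel modulo two. -/
theorem sum_facetFull_middle {n : ℕ} (lam : (Fin n → ℕ) → ℕ) (v : Fin n → ℕ) {k : ℕ}
    (hk : 0 < k) (hkn : k < n) :
    open Classical in
    (∑ σ : Equiv.Perm (Fin n), if FacetFull lam v σ k then (1 : ZMod 2) else 0) = 0 := by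
  classical
  -- Exchanging the steps in positions `k - 1` and `k` moves only the `k`-th vertex.
  set a : Fin n := ⟨k - 1, by omega⟩ with ha
  set b : Fin n := ⟨k, hkn⟩ with hb
  have hab : a ≠ b := by simp only [ha, hb, ne_eq, Fin.mk.injEq]; omega
  have hcongr : ∀ σ : Equiv.Perm (Fin n),
      FacetFull lam v (Equiv.swap a b * σ) k ↔ FacetFull lam v σ k := by
    intro σ
    refine facetFull_congr fun k' _ hk' => ?_
    funext j
    have : ((Equiv.swap a b (σ j) : Fin n) : ℕ) < k' ↔ (σ j : ℕ) < k' := by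
      rw [Equiv.swap_apply_def]
      split_ifs with h1 h2
      · rw [h1]; simp only [ha, hb]; omega
      · rw [h2]; simp only [ha, hb]; omega
      · rfl
    simp [freudenthalVertex, this]
  refine Finset.sum_involution (fun σ _ => Equiv.swap a b * σ) ?_ ?_ ?_ ?_
  · intro σ _
    simp only [hcongr]
    exact CharTwo.add_self_eq_zero _
  · intro σ _ _ h
    exact hab (Equiv.swap_eq_one_iff.1 (mul_eq_right.1 h))
  · simp
  · intro σ _
    simp [← mul_assoc]

/-- Pushing a simplex across the facet opposite to its first vertex. -/
theorem freudenthalVertex_rotate {m : ℕ} (v : Fin (m + 1) → ℕ) (σ : Equiv.Perm (Fin (m + 1)))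
    {k : ℕ} (hk : k ≤ m) :
    freudenthalVertex (v + Pi.single (σ.symm 0) 1) ((finRotate (m + 1))⁻¹ * σ) k =
      freudenthalVertex v σ (k + 1) := by
  funext j
  obtain ⟨i, rfl⟩ := σ.symm.surjective j
  obtain ⟨i, rfl⟩ := (finRotate (m + 1)).surjective i
  simp only [freudenthalVertex, Pi.add_apply, Equiv.Perm.mul_apply, Equiv.apply_symm_apply,
    Equiv.Perm.inv_def, Equiv.symm_apply_apply]
  by_cases hi : i = Fin.last m
  · subst hi
    simp
    omega
  · have h1 : ((finRotate (m + 1) i : Fin (m + 1)) : ℕ) = i + 1 := coe_finRotate_of_ne_last hi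
    have h2 : (σ.symm (finRotate (m + 1) i)) ≠ σ.symm 0 := by
      intro e
      have := congrArg Fin.val (σ.symm.injective e)
      rw [h1] at this
      simp at this
    rw [Pi.single_eq_of_ne h2, h1]
    simp

/-- The rotated simplex starts at the second vertex of the old one and takes the old first step
last, so the two share all vertices but one each. -/
theorem facetFull_rotate {m : ℕ} (lam : (Fin (m + 1) → ℕ) → ℕ) (v : Fin (m + 1) → ℕ)
    (σ : Equiv.Perm (Fin (m + 1))) :
    FacetFull lam (v + Pi.single (σ.symm 0) 1) ((finRotate (m + 1))⁻¹ * σ) (m + 1) ↔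
      FacetFull lam v σ 0 := by
  refine forall₂_congr fun c _ => ?_
  constructor
  · rintro ⟨k, hk, hne, h⟩
    rw [freudenthalVertex_rotate v σ (by omega)] at h
    exact ⟨k + 1, by omega, by omega, h⟩
  · rintro ⟨k, hk, hne, h⟩
    refine ⟨k - 1, by omega, by omega, ?_⟩
    rw [freudenthalVertex_rotate v σ (by omega), Nat.sub_add_cancel (by omega), h]

/-- The base points of the simplices in the cube of side length `N`. -/
abbrev cubeBase (n N : ℕ) : Finset (Fin n → ℕ) := Fintype.piFinset fun _ => Finset.range N

/-- Label conditions on the boundary of the cube. -/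
structure IsKuhnLabelling (n N : ℕ) (lam : (Fin n → ℕ) → ℕ) : Prop where
  le : ∀ x, (∀ i, x i ≤ N) → lam x ≤ n
  ne : ∀ x, (∀ i, x i ≤ N) → ∀ i : Fin n, x i = 0 → lam x ≠ i + 1
  lt : ∀ x, (∀ i, x i ≤ N) → ∀ i : Fin n, x i = N → (i : ℕ) < lam x

theorem freudenthalVertex_le {n N : ℕ} {v : Fin n → ℕ} (hv : v ∈ cubeBase n N)
    (σ : Equiv.Perm (Fin n)) (k : ℕ) (i : Fin n) : freudenthalVertex v σ k i ≤ N := by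
  have := Finset.mem_range.1 (Fintype.mem_piFinset.1 hv i)
  unfold freudenthalVertex
  split_ifs <;> omega

/-- Such a facet lies in a face `x_i = N` of the cube, where label `0` cannot occur. -/
theorem not_facetFull_zero {m N : ℕ} {lam : (Fin (m + 1) → ℕ) → ℕ}
    (hlam : IsKuhnLabelling (m + 1) N lam) {v : Fin (m + 1) → ℕ} (hv : v ∈ cubeBase (m + 1) N)
    {σ : Equiv.Perm (Fin (m + 1))} (h : N ≤ v (σ.symm 0) + 1) : ¬ FacetFull lam v σ 0 := by
  intro hd
  obtain ⟨k, hk, hne, he⟩ := hd 0 (by omega)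
  have hlt := Finset.mem_range.1 (Fintype.mem_piFinset.1 hv (σ.symm 0))
  have := hlam.lt _ (freudenthalVertex_le hv σ k) (σ.symm 0) (by
    simp only [freudenthalVertex, Equiv.apply_symm_apply, Fin.val_zero]
    rw [if_pos (by omega)]
    omega)
  omega

/-- The facet lies in the face `x_i = 0` with `i = σ.symm (Fin.last m)`, where label `i + 1` is
forbidden; for `i < m` that label is required of a full facet. -/
theorem symm_last_of_facetFull {m N : ℕ} {lam : (Fin (m + 1) → ℕ) → ℕ}
    (hlam : IsKuhnLabelling (m + 1) N lam) {v : Fin (m + 1) → ℕ} (hv : v ∈ cubeBase (m + 1) N)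
    {σ : Equiv.Perm (Fin (m + 1))} (h : v (σ.symm (Fin.last m)) = 0)
    (hd : FacetFull lam v σ (m + 1)) : σ.symm (Fin.last m) = Fin.last m := by
  by_contra hne
  have hlt : (σ.symm (Fin.last m) : ℕ) < m := Fin.val_lt_last hne
  obtain ⟨k, hk, hk', he⟩ := hd (σ.symm (Fin.last m) + 1) (by omega)
  refine hlam.ne _ (freudenthalVertex_le hv σ k) (σ.symm (Fin.last m)) ?_ he
  simp only [freudenthalVertex, Equiv.apply_symm_apply, Fin.val_last, h]
  rw [if_neg (by omega)]

/-- A permutation of `Fin m` extended to fix the last element of `Fin (m + 1)`. -/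
def permSnoc {m : ℕ} (σ : Equiv.Perm (Fin m)) : Equiv.Perm (Fin (m + 1)) :=
  finSuccEquivLast.symm.permCongr (Equiv.optionCongr σ)

theorem permSnoc_castSucc {m : ℕ} (σ : Equiv.Perm (Fin m)) (i : Fin m) :
    permSnoc σ i.castSucc = (σ i).castSucc := by
  simp [permSnoc, Equiv.permCongr_apply]

theorem permSnoc_last {m : ℕ} (σ : Equiv.Perm (Fin m)) :
    permSnoc σ (Fin.last m) = Fin.last m := by
  simp [permSnoc, Equiv.permCongr_apply]

theorem permSnoc_injective {m : ℕ} : Function.Injective (permSnoc (m := m)) := by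
  intro σ τ h
  ext i
  have := congrArg (fun ρ : Equiv.Perm (Fin (m + 1)) => (ρ i.castSucc : ℕ)) h
  simpa [permSnoc_castSucc] using this

theorem exists_permSnoc {m : ℕ} (σ : Equiv.Perm (Fin (m + 1))) (h : σ (Fin.last m) = Fin.last m) :
    ∃ τ, permSnoc τ = σ := by
  refine ⟨Equiv.removeNone (finSuccEquivLast.permCongr σ), ?_⟩
  have hn : finSuccEquivLast.permCongr σ none = none := by
    simp [Equiv.permCongr_apply, h]
  unfold permSnoc
  have : Equiv.optionCongr (Equiv.removeNone (finSuccEquivLast.permCongr σ)) =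
      finSuccEquivLast.permCongr σ := by
    ext1 x
    cases x with
    | none => simpa using hn.symm
    | some x =>
      simp only [Equiv.optionCongr_apply, Option.map_some]
      exact Equiv.removeNone_some _ (by
        rw [← Option.ne_none_iff_exists']
        intro e
        exact absurd ((finSuccEquivLast.permCongr σ).injective (e.trans hn.symm)) (by simp))
  rw [this]
  ext
  simp [Equiv.permCongr_apply]

theorem freudenthalVertex_snoc {m : ℕ} (v : Fin m → ℕ) (σ : Equiv.Perm (Fin m)) {k : ℕ}
    (hk : k ≤ m) :
    freudenthalVertex (Fin.snoc v 0 : Fin (m + 1) → ℕ) (permSnoc σ) k =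
      (Fin.snoc (freudenthalVertex v σ k) 0 : Fin (m + 1) → ℕ) := by
  funext j
  refine Fin.lastCases ?_ (fun i => ?_) j
  · simp [freudenthalVertex, permSnoc_last]
    omega
  · simp [freudenthalVertex, permSnoc_castSucc]

/-- A facet in the bottom face `x_m = 0` is itself a simplex of the triangulated `m`-cube; this
drives the induction on dimension. -/
theorem facetFull_snoc {m : ℕ} (lam : (Fin (m + 1) → ℕ) → ℕ) (v : Fin m → ℕ)
    (σ : Equiv.Perm (Fin m)) :
    FacetFull lam (Fin.snoc v 0 : Fin (m + 1) → ℕ) (permSnoc σ) (m + 1) ↔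
      SimplexFull (fun x => lam (Fin.snoc x 0 : Fin (m + 1) → ℕ)) v σ := by
  constructor
  · intro h c hc
    obtain ⟨k, hk, hne, he⟩ := h c (by omega)
    refine ⟨k, by omega, ?_⟩
    rw [freudenthalVertex_snoc v σ (by omega)] at he
    exact he
  · intro h c hc
    obtain ⟨k, hk, he⟩ := h c (by omega)
    exact ⟨k, by omega, by omega, by rw [freudenthalVertex_snoc v σ hk]; exact he⟩

theorem IsKuhnLabelling.snoc {m N : ℕ} {lam : (Fin (m + 1) → ℕ) → ℕ}
    (hlam : IsKuhnLabelling (m + 1) N lam) :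
    IsKuhnLabelling m N (fun x => lam (Fin.snoc x 0 : Fin (m + 1) → ℕ)) := by
  have hx : ∀ x : Fin m → ℕ, (∀ i, x i ≤ N) →
      ∀ i, (Fin.snoc x 0 : Fin (m + 1) → ℕ) i ≤ N := by
    intro x hx i
    refine Fin.lastCases ?_ (fun i => ?_) i
    · simp
    · simpa using hx i
  refine ⟨fun x h => ?_, fun x h i hi => ?_, fun x h i hi => ?_⟩
  · have h1 := hlam.le _ (hx x h)
    have h2 := hlam.ne _ (hx x h) (Fin.last m) (by simp)
    simp only [Fin.val_last] at h2
    omega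
  · simpa using hlam.ne _ (hx x h) i.castSucc (by simpa using hi)
  · simpa using hlam.lt _ (hx x h) i.castSucc (by simpa using hi)

-- Facets opposite last vertices are matched by rotation with facets opposite first vertices of
-- neighbouring simplices. The unmatched ones lie on the boundary of the cube, and there only the
-- bottom face `x_m = 0` carries full facets.
open Finset in
theorem sum_facetFull_ends {m N : ℕ} {lam : (Fin (m + 1) → ℕ) → ℕ}
    (hlam : IsKuhnLabelling (m + 1) N lam) (hN : 0 < N) :
    open Classical in
    (∑ p ∈ cubeBase (m + 1) N ×ˢ (univ : Finset (Equiv.Perm (Fin (m + 1)))),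
        if FacetFull lam p.1 p.2 (m + 1) then (1 : ZMod 2) else 0) =
      (∑ p ∈ cubeBase (m + 1) N ×ˢ (univ : Finset (Equiv.Perm (Fin (m + 1)))),
        if FacetFull lam p.1 p.2 0 then (1 : ZMod 2) else 0) +
      ∑ p ∈ cubeBase m N ×ˢ (univ : Finset (Equiv.Perm (Fin m))),
        if SimplexFull (fun x => lam (Fin.snoc x 0 : Fin (m + 1) → ℕ)) p.1 p.2
          then (1 : ZMod 2) else 0 := by
  classical
  rw [← sum_filter_not_add_sum_filter _ (fun p => p.1 (p.2.symm (Fin.last m)) = 0)]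
  congr 1
  · rw [← sum_filter_add_sum_filter_not (cubeBase (m + 1) N ×ˢ univ)
      (fun p => p.1 (p.2.symm 0) + 1 < N) (fun p => if FacetFull lam p.1 p.2 0 then _ else _)]
    refine Eq.trans ?_ (congrArg₂ (· + ·) rfl (sum_eq_zero
      (s := filter (fun p => ¬ p.1 (p.2.symm 0) + 1 < N)
      (cubeBase (m + 1) N ×ˢ (univ : Finset (Equiv.Perm (Fin (m + 1)))))) ?_)).symm
    · rw [add_zero]
      symm
      refine sum_bij' (fun p _ => (p.1 + Pi.single (p.2.symm 0) 1, (finRotate (m + 1))⁻¹ * p.2))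
        (fun p _ => (p.1 - Pi.single (p.2.symm (Fin.last m)) 1, finRotate (m + 1) * p.2))
        ?_ ?_ ?_ ?_ ?_
      · rintro ⟨v, σ⟩ h
        simp only [mem_filter, mem_product, Fintype.mem_piFinset, mem_range, mem_univ,
          and_true] at h ⊢
        refine ⟨fun i => ?_, ?_⟩
        · by_cases hi : i = σ.symm 0
          · subst hi
            simpa using h.2
          · simpa [Pi.single_eq_of_ne hi] using h.1 i
        · have : ((finRotate (m + 1))⁻¹ * σ).symm (Fin.last m) = σ.symm 0 := by
            rw [Equiv.symm_apply_eq]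
            rw [Equiv.Perm.mul_apply, Equiv.apply_symm_apply, Equiv.Perm.eq_inv_iff_eq,
              finRotate_last]
          rw [this]
          simp
      · rintro ⟨v, σ⟩ h
        simp only [mem_filter, mem_product, Fintype.mem_piFinset, mem_range, mem_univ,
          and_true] at h ⊢
        refine ⟨fun i => lt_of_le_of_lt (Nat.sub_le _ _) (h.1 i), ?_⟩
        have : (finRotate (m + 1) * σ).symm 0 = σ.symm (Fin.last m) := by
          rw [Equiv.symm_apply_eq]
          simp
        rw [this]
        have := h.1 (σ.symm (Fin.last m))
        simp
        omega
      · rintro ⟨v, σ⟩ h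
        have : ((finRotate (m + 1))⁻¹ * σ).symm (Fin.last m) = σ.symm 0 := by
          rw [Equiv.symm_apply_eq]
          rw [Equiv.Perm.mul_apply, Equiv.apply_symm_apply, Equiv.Perm.eq_inv_iff_eq,
              finRotate_last]
        simp [this]
      · rintro ⟨v, σ⟩ h
        simp only [mem_filter, mem_product, Fintype.mem_piFinset, mem_range, mem_univ,
          and_true] at h
        have : (finRotate (m + 1) * σ).symm 0 = σ.symm (Fin.last m) := by
          rw [Equiv.symm_apply_eq]
          simp
        simp only [this, inv_mul_cancel_left, Prod.mk.injEq, and_true]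
        refine tsub_add_cancel_of_le fun i => ?_
        by_cases hi : i = σ.symm (Fin.last m)
        · subst hi
          simpa using Nat.one_le_iff_ne_zero.2 h.2
        · simp [Pi.single_eq_of_ne hi]
      · rintro ⟨v, σ⟩ _
        simp only [facetFull_rotate]
    · rintro ⟨v, σ⟩ h
      simp only [mem_filter, mem_product] at h
      exact if_neg (not_facetFull_zero hlam h.1.1 (by simpa using h.2))
  · symm
    refine sum_bij_ne_zero
      (fun p _ _ => ((Fin.snoc p.1 0 : Fin (m + 1) → ℕ), permSnoc p.2)) ?_ ?_ ?_ ?_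
    · rintro ⟨v, σ⟩ h _
      simp only [mem_filter, mem_product, Fintype.mem_piFinset, mem_range, mem_univ,
        and_true] at h ⊢
      have hl : (permSnoc σ).symm (Fin.last m) = Fin.last m := by
        rw [Equiv.symm_apply_eq, permSnoc_last]
      refine ⟨fun i => ?_, by simp [hl]⟩
      refine Fin.lastCases ?_ (fun i => ?_) i
      · simpa using hN
      · simpa using h i
    · rintro ⟨v, σ⟩ _ _ ⟨w, τ⟩ _ _ h
      simp only [Prod.mk.injEq] at h ⊢
      refine ⟨?_, permSnoc_injective h.2⟩
      have := congrArg Fin.init h.1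
      simpa using this
    · rintro ⟨v, σ⟩ h hne
      simp only [ne_eq, ite_eq_right_iff, one_ne_zero, imp_false, not_not] at hne
      simp only [mem_filter, mem_product] at h
      have hl := symm_last_of_facetFull hlam h.1.1 h.2 hne
      obtain ⟨τ, rfl⟩ := exists_permSnoc σ ((Equiv.symm_apply_eq _).1 hl).symm
      have hv : (Fin.snoc (Fin.init v) 0 : Fin (m + 1) → ℕ) = v := by
        conv_rhs => rw [← Fin.snoc_init_self v]
        have h2 := h.2
        rw [hl] at h2
        rw [h2]
      refine ⟨(Fin.init v, τ), ?_, ?_, ?_⟩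
      · simp only [mem_product, Fintype.mem_piFinset, mem_univ, and_true]
        intro i
        exact Fintype.mem_piFinset.1 h.1.1 i.castSucc
      · rw [← hv, facetFull_snoc] at hne
        simp [hne]
      · simp [hv]
    · rintro ⟨v, σ⟩ _ _
      simp only [facetFull_snoc]

open Finset in
/-- Kuhn's cubical form of Sperner's lemma: the number of fully labelled simplices is odd. -/
theorem sum_simplexFull (n : ℕ) {N : ℕ} (hN : 0 < N) (lam : (Fin n → ℕ) → ℕ)
    (hlam : IsKuhnLabelling n N lam) :
    open Classical in
    (∑ p ∈ cubeBase n N ×ˢ (univ : Finset (Equiv.Perm (Fin n))),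
      if SimplexFull lam p.1 p.2 then (1 : ZMod 2) else 0) = 1 := by
  classical
  induction n with
  | zero =>
    have : ∀ v σ, SimplexFull lam v σ := by
      intro v σ c hc
      have := hlam.le (freudenthalVertex v σ 0) (fun i => i.elim0)
      exact ⟨0, le_rfl, by omega⟩
    simp [this]
  | succ m ih =>
    have h1 : ∀ p ∈ cubeBase (m + 1) N ×ˢ (univ : Finset (Equiv.Perm (Fin (m + 1)))),
        (if SimplexFull lam p.1 p.2 then (1 : ZMod 2) else 0) =
          ∑ k ∈ range (m + 2), if FacetFull lam p.1 p.2 k then (1 : ZMod 2) else 0 := by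
      rintro ⟨v, σ⟩ hp
      symm
      have := sum_facets_full_eq (m + 1) (fun k => lam (freudenthalVertex v σ k))
        (fun k _ => hlam.le _ (freudenthalVertex_le (mem_product.1 hp).1 σ k))
      convert this <;> rfl
    -- Double counting of pairs (simplex, full facet): the middle facets cancel, the two end sums
    -- cancel up to the bottom face, and that face contributes `1` by induction.
    rw [sum_congr rfl h1, sum_comm, sum_range_succ, sum_range_succ', sum_facetFull_ends hlam hN,
      ih _ hlam.snoc, sum_eq_zero, zero_add, ← add_assoc, CharTwo.add_self_eq_zero, zero_add]
    intro k hk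
    rw [sum_product]
    exact sum_eq_zero fun v _ => sum_facetFull_middle lam v (by omega)
      (by have := mem_range.1 hk; omega)

theorem exists_simplexFull (n : ℕ) {N : ℕ} (hN : 0 < N) (lam : (Fin n → ℕ) → ℕ)
    (hlam : IsKuhnLabelling n N lam) :
    ∃ v ∈ cubeBase n N, ∃ σ, SimplexFull lam v σ := by
  classical
  by_contra! h
  have := sum_simplexFull n hN lam hlam
  rw [Finset.sum_eq_zero] at this
  · exact zero_ne_one this
  · intro p hp
    exact if_neg (h p.1 (Finset.mem_product.1 hp).1 p.2)

/-- A covering form of Kuhn's lemma: an open cover of the cube by `n + 1` sets satisfying the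
boundary conditions of `IsKuhnLabelling` has a common point. -/
theorem exists_mem_iInter_of_kuhn_cover (n : ℕ) (W : Fin (n + 1) → Set (Fin n → unitInterval))
    (hW : ∀ j, IsOpen (W j)) (hcov : ∀ t, ∃ j, t ∈ W j)
    (h0 : ∀ t, ∀ i : Fin n, t i = 0 → t ∉ W i.succ)
    (h1 : ∀ t, ∀ i : Fin n, t i = 1 → ∀ j, t ∈ W j → i.castSucc < j) :
    ∃ t, ∀ j, t ∈ W j := by
  obtain ⟨δ, hδ, hδW⟩ := lebesgue_number_lemma_of_metric (s := Set.univ) isCompact_univ hW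
    (fun t _ => Set.mem_iUnion.2 (hcov t))
  -- The mesh `1 / N` is below the Lebesgue number, and a grid point is labelled by a set containing
  -- its whole `δ`-ball.
  obtain ⟨N, hN⟩ := exists_nat_gt (1 / δ)
  have hN0 : (0 : ℝ) < N := lt_trans (by positivity) hN
  have hNδ : (1 : ℝ) / N < δ := by
    rw [div_lt_iff₀ hN0]
    rw [div_lt_iff₀ hδ] at hN
    linarith
  let pt : (Fin n → ℕ) → (Fin n → unitInterval) := fun x i =>
    Set.projIcc (0 : ℝ) 1 zero_le_one ((x i : ℝ) / N)
  choose! l hl using fun t (_ : t ∈ Set.univ) => hδW t (Set.mem_univ t)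
  have hlmem : ∀ t, t ∈ W (l t) := fun t =>
    hl t (Set.mem_univ t) (Metric.mem_ball_self hδ)
  obtain ⟨v, -, σ, hfull⟩ := exists_simplexFull n (Nat.cast_pos.1 hN0) (fun x => (l (pt x) : ℕ))
    { le := fun x _ => Nat.lt_succ_iff.1 (l (pt x)).2
      ne := fun x _ i hi e => by
        have hp : pt x i = 0 := by
          apply Subtype.ext
          simp [pt, hi, Set.projIcc]
        refine h0 (pt x) i hp ?_
        have : l (pt x) = i.succ := Fin.ext (by simpa using e)
        exact this ▸ hlmem (pt x)
      lt := fun x _ i hi => by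
        have hp : pt x i = 1 := by
          apply Subtype.ext
          simp [pt, hi, Set.projIcc, hN0.ne']
        exact h1 (pt x) i hp _ (hlmem (pt x)) }
  -- The base vertex of the full simplex is within `1 / N` of each vertex, hence in the ball
  -- belonging to every label.
  refine ⟨pt v, fun j => ?_⟩
  obtain ⟨k, -, hk⟩ := hfull j (Nat.lt_succ_iff.1 j.2)
  have hk' : l (pt (freudenthalVertex v σ k)) = j := Fin.ext hk
  rw [← hk']
  refine hl _ (Set.mem_univ _) ?_
  rw [Metric.mem_ball]
  refine lt_of_le_of_lt ((dist_pi_le_iff (by positivity)).2 fun i => ?_) hNδ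
  have : dist (pt v i) (pt (freudenthalVertex v σ k) i) ≤
      dist ((v i : ℝ) / N) ((freudenthalVertex v σ k i : ℝ) / N) := by
    have := (LipschitzWith.projIcc (a := (0 : ℝ)) (b := 1) zero_le_one).dist_le_mul
      ((v i : ℝ) / N) ((freudenthalVertex v σ k i : ℝ) / N)
    simpa using this
  refine this.trans ?_
  rw [Real.dist_eq, ← sub_div, abs_div, abs_of_pos hN0]
  gcongr
  unfold freudenthalVertex
  split_ifs <;> simp

/-! ### Comparison triangles, geodesics and cones in `CAT(0)` spaces. -/

/-- Every triple of lengths satisfying the triangle inequalities is realized in the plane. -/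
theorem exists_comparison_triangle {a b c : ℝ} (ha : 0 ≤ a) (hc : 0 ≤ c)
    (h1 : a ≤ c + b) (h2 : b ≤ a + c) (h3 : c ≤ a + b) :
    ∃ x y z : EuclideanSpace ℝ (Fin 2), dist x y = a ∧ dist y z = b ∧ dist x z = c := by
  have hb : 0 ≤ b := by linarith
  rcases ha.eq_or_lt with rfl | ha
  · refine ⟨0, 0, !₂[c, 0], by simp, ?_, ?_⟩ <;>
    · rw [EuclideanSpace.dist_eq]
      simp [Real.dist_eq, Real.sqrt_sq_eq_abs, abs_of_nonneg hc]
      try linarith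
  -- The first coordinate of the third vertex, from the law of cosines with the side `a` along the
  -- axis.
  · set w : ℝ := (a ^ 2 + c ^ 2 - b ^ 2) / (2 * a) with hw
    have haw : 2 * a * w = a ^ 2 + c ^ 2 - b ^ 2 := by rw [hw]; field_simp
    have hle : w ^ 2 ≤ c ^ 2 := by
      rw [sq_le_sq, abs_of_nonneg hc, abs_le]
      constructor
      · have : 0 ≤ (2 * a) * (w + c) := by nlinarith
        have := nonneg_of_mul_nonneg_right this (by positivity)
        linarith
      · have : 0 ≤ (2 * a) * (c - w) := by nlinarith
        have := nonneg_of_mul_nonneg_right this (by positivity)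
        linarith
    have hs : Real.sqrt (c ^ 2 - w ^ 2) ^ 2 = c ^ 2 - w ^ 2 := Real.sq_sqrt (by linarith)
    refine ⟨0, !₂[a, 0], !₂[w, Real.sqrt (c ^ 2 - w ^ 2)], ?_, ?_, ?_⟩ <;>
      rw [EuclideanSpace.dist_eq, Fin.sum_univ_two, Real.sqrt_eq_iff_mul_self_eq (by positivity)
        (by positivity)] <;>
      simp only [Real.dist_eq, sq_abs] <;> simp <;> nlinarith

section CAT0

variable {X : Type u} [MetricSpace X]

theorem exists_comparison_triangle_of_metric (x y z : X) :
    ∃ x' y' z' : EuclideanSpace ℝ (Fin 2),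
      dist x' y' = dist x y ∧ dist y' z' = dist y z ∧ dist x' z' = dist x z := by
  refine exists_comparison_triangle dist_nonneg dist_nonneg ?_ ?_ ?_
  · rw [dist_comm y z]
    exact dist_triangle _ _ _
  · rw [dist_comm x y]
    exact dist_triangle _ _ _
  · exact dist_triangle _ _ _

/-- The median inequality of Bruhat and Tits. -/
theorem IsCAT0.exists_midpoint (h : IsCAT0 X) (x y : X) :
    ∃ m : X, ∀ z, dist m z ^ 2 ≤ (dist x z ^ 2 + dist y z ^ 2) / 2 - dist x y ^ 2 / 4 := by
  obtain ⟨α, hα⟩ := h.geodesic x y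
  refine ⟨α (1 / 2), fun z => ?_⟩
  obtain ⟨β, hβ⟩ := h.geodesic x z
  obtain ⟨x', y', z', h1, h2, h3⟩ := exists_comparison_triangle_of_metric x y z
  -- The midpoint of one side is compared with the opposite vertex; Apollonius' identity in the
  -- plane finishes.
  have key := h.comparison x y z α β hα hβ x' y' z' h1 h2 h3 (1 / 2) ⟨by norm_num, by norm_num⟩ 1
    ⟨zero_le_one, le_rfl⟩
  rw [hβ.2.1, AffineMap.lineMap_apply_one, one_div,
    show AffineMap.lineMap x' y' (2⁻¹ : ℝ) = midpoint ℝ x' y' by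
      rw [midpoint, invOf_eq_inv]] at key
  have hap := EuclideanGeometry.dist_sq_add_dist_sq_eq_two_mul_dist_midpoint_sq_add_half_dist_sq
    z' x' y'
  rw [dist_comm z' x', dist_comm z' y', dist_comm z', h1, h2, h3] at hap
  rw [one_div]
  have := pow_le_pow_left₀ dist_nonneg key 2
  linarith

/-- In the comparison triangle the two points are images of `y'` and `z'` under the homothety of
ratio `t` at `x'`. Uniqueness of geodesics and their continuous dependence on the endpoint follow.
-/
theorem IsCAT0.dist_geodesic_le (h : IsCAT0 X) {x y z : X} {α β : ℝ → X}
    (hα : IsGeodesicPath α x y) (hβ : IsGeodesicPath β x z) {t : ℝ} (ht : t ∈ Set.Icc (0 : ℝ) 1) :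
    dist (α t) (β t) ≤ t * dist y z := by
  obtain ⟨x', y', z', h1, h2, h3⟩ := exists_comparison_triangle_of_metric x y z
  refine (h.comparison x y z α β hα hβ x' y' z' h1 h2 h3 t ht t ht).trans (le_of_eq ?_)
  rw [← h2, AffineMap.lineMap_apply_module, AffineMap.lineMap_apply_module, dist_add_left,
    dist_smul₀, Real.norm_eq_abs, abs_of_nonneg ht.1]

theorem IsCAT0.geodesic_unique (h : IsCAT0 X) {x y : X} {α β : ℝ → X}
    (hα : IsGeodesicPath α x y) (hβ : IsGeodesicPath β x y) {t : ℝ} (ht : t ∈ Set.Icc (0 : ℝ) 1) :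
    α t = β t := by
  have := h.dist_geodesic_le hα hβ ht
  rw [dist_self, mul_zero] at this
  exact dist_le_zero.1 this

/-- The geodesic from `x` to `y`. -/
noncomputable def IsCAT0.geo (h : IsCAT0 X) (x y : X) : ℝ → X := (h.geodesic x y).choose

theorem IsCAT0.isGeodesicPath_geo (h : IsCAT0 X) (x y : X) : IsGeodesicPath (h.geo x y) x y :=
  (h.geodesic x y).choose_spec

theorem IsCAT0.continuous_geo (h : IsCAT0 X) (x : X) :
    Continuous fun q : X × unitInterval => h.geo x q.1 q.2 := by
  rw [continuous_iff_continuousAt]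
  rintro ⟨y, t⟩
  refine tendsto_iff_dist_tendsto_zero.2 (squeeze_zero (fun _ => dist_nonneg)
    (g := fun q : X × unitInterval => dist q.1 y + |(q.2 : ℝ) - t| * dist x y) ?_ ?_)
  · rintro ⟨y', t'⟩
    refine (dist_triangle _ (h.geo x y t') _).trans (add_le_add ?_ ?_)
    · refine (h.dist_geodesic_le (h.isGeodesicPath_geo x y') (h.isGeodesicPath_geo x y)
        t'.2).trans ?_
      exact mul_le_of_le_one_left dist_nonneg t'.2.2
    · exact ((h.isGeodesicPath_geo x y).2.2 _ t'.2 _ t.2).le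
  · have : Continuous fun q : X × unitInterval => dist q.1 y + |(q.2 : ℝ) - t| * dist x y := by
      fun_prop
    simpa using this.tendsto (y, t)

/-- The iterated geodesic cone over the points `p 0, p 1, …, p m`. -/
noncomputable def IsCAT0.cone (h : IsCAT0 X) (p : ℕ → X) : ℕ → (ℕ → unitInterval) → X
  | 0, _ => p 0
  -- The geodesic starts at the fixed apex because `continuous_geo` varies only the other endpoint.
  -- The reversed parameter makes `t m = 0` ignore the apex and `t m = 1` collapse to it.
  | m + 1, t => h.geo (p (m + 1)) (h.cone p m t) (unitInterval.symm (t m))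

theorem IsCAT0.continuous_cone (h : IsCAT0 X) (p : ℕ → X) (m : ℕ) : Continuous (h.cone p m) := by
  induction m with
  | zero => exact continuous_const
  | succ m ih =>
    exact (h.continuous_geo (p (m + 1))).comp
      (ih.prodMk (unitInterval.continuous_symm.comp (continuous_apply m)))

theorem IsCAT0.cone_of_eq_zero (h : IsCAT0 X) (p : ℕ → X) {m : ℕ} {t : ℕ → unitInterval}
    (ht : t m = 0) : h.cone p (m + 1) t = h.cone p m t := by
  have := (h.isGeodesicPath_geo (p (m + 1)) (h.cone p m t)).2.1
  simpa [IsCAT0.cone, ht] using this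

theorem IsCAT0.cone_of_eq_one (h : IsCAT0 X) (p : ℕ → X) {m : ℕ} {t : ℕ → unitInterval}
    (ht : t m = 1) : h.cone p (m + 1) t = p (m + 1) := by
  have := (h.isGeodesicPath_geo (p (m + 1)) (h.cone p m t)).1
  simpa [IsCAT0.cone, ht] using this

/-! ### Convex sets and Helly's theorem. -/

/-- Closed under geodesics. -/
def GeodesicallyConvex (C : Set X) : Prop :=
  ∀ x ∈ C, ∀ y ∈ C, ∀ γ : ℝ → X, IsGeodesicPath γ x y → ∀ t ∈ Set.Icc (0 : ℝ) 1, γ t ∈ C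

theorem IsCAT0.cone_mem (h : IsCAT0 X) (p : ℕ → X) {C : Set X} (hC : GeodesicallyConvex C)
    (t : ℕ → unitInterval) {a b : ℕ} (hab : a ≤ b) (ha : h.cone p a t ∈ C)
    (hp : ∀ k, a < k → k ≤ b → p k ∈ C) : h.cone p b t ∈ C := by
  induction b, hab using Nat.le_induction with
  | base => exact ha
  | succ b hb ih =>
    exact hC _ (hp (b + 1) (by omega) le_rfl) _ (ih fun k h1 h2 => hp k h1 (by omega)) _
      (h.isGeodesicPath_geo _ _) _ (unitInterval.symm (t b)).2

/-- Helly's theorem for `n + 1` closed convex subsets of a `CAT(0)` space of covering dimension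
less than `n`. -/
theorem IsCAT0.helly (h : IsCAT0 X) {d n : ℕ} (hd : CoveringDimLE X d) (hdn : d < n)
    (C : Fin (n + 1) → Set X) (hcl : ∀ j, IsClosed (C j)) (hC : ∀ j, GeodesicallyConvex (C j))
    (p : Fin (n + 1) → X) (hp : ∀ k j, k ≠ j → p k ∈ C j) : ∃ x, ∀ j, x ∈ C j := by
  by_contra! hempty
  obtain ⟨V, hVo, hVc, hVr, hVd⟩ := hd (Set.range fun j => (C j)ᶜ)
    (by rintro _ ⟨j, rfl⟩; exact (hcl j).isOpen_compl)
    (by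
      rw [Set.eq_univ_iff_forall]
      intro x
      obtain ⟨j, hj⟩ := hempty x
      exact ⟨_, ⟨j, rfl⟩, hj⟩)
  have hVr' : ∀ B ∈ V, ∃ j, B ⊆ (C j)ᶜ := by
    intro B hB
    obtain ⟨_, ⟨j, rfl⟩, hj⟩ := hVr B hB
    exact ⟨j, hj⟩
  choose! ι hι using hVr'
  let q : ℕ → X := fun k => p (Fin.ofNat (n + 1) k)
  have hq : ∀ (k : ℕ) (j : Fin (n + 1)), k ≤ n → k ≠ j → q k ∈ C j := by
    intro k j hk hkj
    refine hp _ _ fun e => hkj ?_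
    rw [← e, Fin.val_ofNat, Nat.mod_eq_of_lt (by omega)]
  let ext : (Fin n → unitInterval) → ℕ → unitInterval := fun τ k =>
    if hk : k < n then τ ⟨k, hk⟩ else 0
  have hext : ∀ τ (i : Fin n), ext τ i = τ i := fun τ i => by simp [ext]
  have hextc : Continuous ext := by
    refine continuous_pi fun k => ?_
    by_cases hk : k < n
    · simpa [ext, hk] using continuous_apply _
    · simpa [ext, hk] using continuous_const
  let F : (Fin n → unitInterval) → X := fun τ => h.cone q n (ext τ)
  have hF : Continuous F := (h.continuous_cone q n).comp hextc
  -- Members of the refinement are grouped by a convex set that they avoid, giving one open set for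
  -- each index.
  let U : Fin (n + 1) → Set X := fun j => ⋃₀ {B ∈ V | ι B = j}
  have hUC : ∀ j x, x ∈ U j → x ∉ C j := by
    rintro j x ⟨B, ⟨hB, rfl⟩, hx⟩
    exact hι B hB hx
  obtain ⟨τ, hτ⟩ := exists_mem_iInter_of_kuhn_cover n (fun j => F ⁻¹' U j)
    (fun j => (isOpen_sUnion fun B hB => hVo B hB.1).preimage hF)
    (fun τ => by
      have : F τ ∈ ⋃₀ V := hVc ▸ Set.mem_univ _
      obtain ⟨B, hB, hx⟩ := this
      exact ⟨ι B, B, ⟨hB, rfl⟩, hx⟩)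
    -- At `τ i = 0` the cone skips the point of index `i + 1`, the only one that may lie outside the
    -- set of that index.
    (fun τ i hi hmem => by
      refine hUC _ _ hmem ?_
      refine h.cone_mem q (hC _) _ (a := i + 1) (by omega) ?_ ?_
      · rw [h.cone_of_eq_zero q ((hext τ i).trans hi)]
        refine h.cone_mem q (hC _) _ (Nat.zero_le _) ?_ ?_
        · exact hq 0 _ (by omega) (by simp)
        · intro k _ hk
          refine hq k _ (by omega) (by rw [Fin.val_succ]; omega)
      · intro k hk hkn
        exact hq k _ hkn (by rw [Fin.val_succ]; omega))
    -- At `τ i = 1` the cone restarts at the point of index `i + 1` and uses only later ones, all of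
    -- which lie in the sets of index at most `i`.
    (fun τ i hi j hmem => by
      by_contra hlt
      have hji : (j : ℕ) ≤ i := by simpa [Fin.lt_def] using hlt
      refine hUC _ _ hmem ?_
      refine h.cone_mem q (hC _) _ (a := i + 1) (by omega) ?_ ?_
      · rw [h.cone_of_eq_one q ((hext τ i).trans hi)]
        exact hq _ _ (by omega) (by omega)
      · intro k hk hkn
        exact hq k _ hkn (by omega))
  have hB : ∀ j, ∃ B ∈ V, ι B = j ∧ F τ ∈ B := by
    intro j
    obtain ⟨B, ⟨hB, hj⟩, hx⟩ := hτ j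
    exact ⟨B, hB, hj, hx⟩
  choose B hBV hBι hBx using hB
  -- The groups are disjoint, so these are `n + 1` distinct members through one point, more than `d
  -- + 1`.
  have hinj : Function.Injective B := fun i j e => by rw [← hBι i, e, hBι j]
  have hsub : Set.range B ⊆ {B ∈ V | F τ ∈ B} := by
    rintro _ ⟨j, rfl⟩
    exact ⟨hBV j, hBx j⟩
  have hle := (hinj.encard_range.trans (Set.encard_le_encard hsub)).trans (hVd (F τ))
  rw [ENat.card_eq_coe_fintype_card, Fintype.card_fin] at hle
  have : n + 1 ≤ d + 1 := by exact_mod_cast hle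
  omega

/-! ### Fixed points of isometric actions. -/

variable {G : Type*} [Group G] [MulAction G X] [IsIsometricSMul G X]

theorem isGeodesicPath_smul {x y : X} {γ : ℝ → X} (hγ : IsGeodesicPath γ x y) (g : G) :
    IsGeodesicPath (fun t => g • γ t) (g • x) (g • y) :=
  ⟨by simp only [hγ.1], by simp only [hγ.2.1], fun s hs t ht => by
    simpa only [dist_smul] using hγ.2.2 s hs t ht⟩

/-- An isometry fixing both endpoints carries a geodesic to a geodesic with the same endpoints,
which is unique. -/
theorem IsCAT0.geodesicallyConvex_fixedBy (h : IsCAT0 X) (g : G) :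
    GeodesicallyConvex (MulAction.fixedBy X g) := by
  intro x hx y hy γ hγ t ht
  have := isGeodesicPath_smul hγ g
  rw [hx, hy] at this
  exact h.geodesic_unique this hγ ht

theorem isClosed_fixedBy (g : G) : IsClosed (MulAction.fixedBy X g) :=
  isClosed_eq (isometry_smul X g).continuous continuous_id

open Filter Topology in
/-- The Bruhat–Tits fixed point theorem for finite groups. -/
theorem IsCAT0.exists_fixed_of_finite [CompleteSpace X] (h : IsCAT0 X) (K : Subgroup G)
    [Finite K] : ∃ x : X, ∀ g ∈ K, g • x = x := by
  classical
  have := Fintype.ofFinite K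
  obtain ⟨o⟩ := h.nonempty
  -- The fixed point is the minimizer of this invariant function, the barycentre of an orbit.
  let f : X → ℝ := fun x => ∑ k : K, dist x ((k : G) • o) ^ 2
  have hf0 : ∀ x, 0 ≤ f x := fun x => Finset.sum_nonneg fun k _ => by positivity
  have hfc : Continuous f := by fun_prop
  have hbdd : BddBelow (Set.range f) := ⟨0, by rintro _ ⟨x, rfl⟩; exact hf0 x⟩
  have hfinv : ∀ g ∈ K, ∀ x, f (g • x) = f x := by
    intro g hg x
    refine Fintype.sum_equiv (Equiv.mulLeft (⟨g, hg⟩ : K)⁻¹) _ _ fun k => ?_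
    rw [← dist_smul g x]
    simp [smul_smul]
  -- Summing the median inequality over the orbit shows that near-minimizers are close to each
  -- other. This gives both convergence of a minimizing sequence and uniqueness of the minimizer.
  have hpar : ∀ x y, dist x y ^ 2 ≤ 2 * (f x + f y - 2 * iInf f) := by
    intro x y
    obtain ⟨m, hm⟩ := h.exists_midpoint x y
    have h1 : f m ≤ ∑ k : K, ((dist x ((k : G) • o) ^ 2 + dist y ((k : G) • o) ^ 2) / 2
        - dist x y ^ 2 / 4) := Finset.sum_le_sum fun k _ => hm _
    rw [Finset.sum_sub_distrib, ← Finset.sum_div, Finset.sum_add_distrib, Finset.sum_const,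
      Finset.card_univ, nsmul_eq_mul] at h1
    have h2 : iInf f ≤ f m := ciInf_le hbdd m
    have h3 : (1 : ℝ) ≤ Fintype.card K := by exact_mod_cast Fintype.card_pos
    have h4 : 0 ≤ dist x y ^ 2 := by positivity
    change f m ≤ (f x + f y) / 2 - _ at h1
    nlinarith
  have hseq : ∀ k : ℕ, ∃ x, f x < iInf f + 1 / ((k : ℝ) + 1) := by
    intro k
    have : Nonempty X := ⟨o⟩
    exact exists_lt_of_ciInf_lt (lt_add_of_pos_right _ (by positivity))
  choose x hx using hseq
  have hcau : CauchySeq x := by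
    refine cauchySeq_of_le_tendsto_0 (fun k : ℕ => Real.sqrt (4 * (1 / ((k : ℝ) + 1)))) ?_ ?_
    · intro a b k ha hb
      refine Real.le_sqrt_of_sq_le ((hpar _ _).trans ?_)
      have h1 : 1 / ((a : ℝ) + 1) ≤ 1 / ((k : ℝ) + 1) := Nat.one_div_le_one_div ha
      have h2 : 1 / ((b : ℝ) + 1) ≤ 1 / ((k : ℝ) + 1) := Nat.one_div_le_one_div hb
      linarith [hx a, hx b]
    · have := (tendsto_one_div_add_atTop_nhds_zero_nat (𝕜 := ℝ)).const_mul 4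
      simpa only [mul_zero, Real.sqrt_zero] using! (Real.continuous_sqrt.tendsto _).comp this
  obtain ⟨z, hz⟩ := cauchySeq_tendsto_of_complete hcau
  have hfz : f z ≤ iInf f := by
    refine le_of_tendsto_of_tendsto' ((hfc.tendsto z).comp hz)
      (g := fun k : ℕ => iInf f + 1 / ((k : ℝ) + 1)) ?_ fun k => (hx k).le
    simpa using (tendsto_one_div_add_atTop_nhds_zero_nat (𝕜 := ℝ)).const_add (iInf f)
  refine ⟨z, fun g hg => dist_le_zero.1 ?_⟩
  have := hpar (g • z) z
  rw [hfinv g hg] at this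
  nlinarith [dist_nonneg (x := g • z) (y := z)]

/-- A group generated by `n + 1` elements, every `n` of which lie in a finite subgroup, fixes a
point in every complete `CAT(0)` space of covering dimension less than `n` it acts on. -/
theorem IsCAT0.exists_fixed_of_finite_subgroups [CompleteSpace X] (h : IsCAT0 X) {d n : ℕ}
    (hd : CoveringDimLE X d) (hdn : d < n) (s : Fin (n + 1) → G)
    (hs : Subgroup.closure (Set.range s) = ⊤) (K : Fin (n + 1) → Subgroup G)
    (hK : ∀ k, Finite (K k)) (hsK : ∀ k j, k ≠ j → s j ∈ K k) : ∃ x : X, ∀ g : G, g • x = x := by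
  choose p hp using fun k => have := hK k; h.exists_fixed_of_finite (K k)
  obtain ⟨x, hx⟩ := h.helly hd hdn (fun j => MulAction.fixedBy X (s j))
    (fun j => isClosed_fixedBy (s j)) (fun j => h.geodesicallyConvex_fixedBy (s j)) p
    (fun k j hkj => hp k _ (hsK k j hkj))
  refine ⟨x, fun g => ?_⟩
  have hle : Subgroup.closure (Set.range s) ≤ MulAction.stabilizer G x := by
    rw [Subgroup.closure_le]
    rintro _ ⟨j, rfl⟩
    exact hx j
  exact hle (hs ▸ Subgroup.mem_top g)

end CAT0

/-! ### Inner product spaces are `CAT(0)`. -/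

section InnerProduct

variable {V : Type*} [NormedAddCommGroup V] [InnerProductSpace ℝ V]

/-- The right-hand side involves only the side lengths, so in an inner product space the comparison
inequality is an equality. -/
theorem dist_lineMap_lineMap_sq (x y z : V) (s t : ℝ) :
    dist (AffineMap.lineMap x y s) (AffineMap.lineMap x z t) ^ 2 =
      s ^ 2 * dist x y ^ 2 + t ^ 2 * dist x z ^ 2 -
        s * t * (dist x y ^ 2 + dist x z ^ 2 - dist y z ^ 2) := by
  have h1 : dist (AffineMap.lineMap x y s) (AffineMap.lineMap x z t) =
      ‖s • (y - x) - t • (z - x)‖ := by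
    rw [dist_eq_norm, AffineMap.lineMap_apply_module', AffineMap.lineMap_apply_module']
    congr 1
    abel
  have h2 : dist y z = ‖(y - x) - (z - x)‖ := by
    rw [dist_eq_norm]
    congr 1
    abel
  rw [h1, h2, dist_comm x y, dist_comm x z, dist_eq_norm y x, dist_eq_norm z x,
    norm_sub_sq_real (s • (y - x)), norm_sub_sq_real (y - x) (z - x), norm_smul, norm_smul, mul_pow, mul_pow, Real.norm_eq_abs, Real.norm_eq_abs,
    sq_abs, sq_abs, real_inner_smul_left, real_inner_smul_right]
  ring

theorem isGeodesicPath_lineMap (x y : V) : IsGeodesicPath (fun t => AffineMap.lineMap x y t) x y :=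
  ⟨by simp, by simp, fun s _ t _ => by
    rw [dist_lineMap_lineMap, Real.dist_eq]⟩

theorem IsGeodesicPath.eq_lineMap {x y : V} {γ : ℝ → V} (h : IsGeodesicPath γ x y) {t : ℝ}
    (ht : t ∈ Set.Icc (0 : ℝ) 1) : γ t = AffineMap.lineMap x y t := by
  refine eq_lineMap_of_dist_eq_mul_of_dist_eq_mul ?_ ?_
  · have := h.2.2 0 ⟨le_rfl, zero_le_one⟩ t ht
    rwa [h.1, zero_sub, abs_neg, abs_of_nonneg ht.1] at this
  · have := h.2.2 t ht 1 ⟨zero_le_one, le_rfl⟩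
    rwa [h.2.1, abs_sub_comm, abs_of_nonneg (sub_nonneg.2 ht.2)] at this

end InnerProduct

theorem isCAT0_of_innerProductSpace (V : Type u) [NormedAddCommGroup V] [InnerProductSpace ℝ V] :
    IsCAT0 V where
  nonempty := ⟨0⟩
  geodesic x y := ⟨_, isGeodesicPath_lineMap x y⟩
  comparison x y z α β hα hβ x' y' z' h1 h2 h3 s hs t ht := by
    rw [hα.eq_lineMap hs, hβ.eq_lineMap ht]
    refine (sq_le_sq₀ dist_nonneg dist_nonneg).1 (le_of_eq ?_)
    rw [dist_lineMap_lineMap_sq, dist_lineMap_lineMap_sq, h1, h2, h3]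

/-! ### The covering dimension of `ℝ^n` is at most `n`. -/

section CoveringDimension

variable {ι : Type*}

/-- Open boxes whose corners have coordinates in the dense set `ℚ + s√2`. -/
def shiftedBox (s : ℕ) (q : ι → ℚ × ℚ) : Set (ι → ℝ) :=
  {x | ∀ j, (q j).1 + s * Real.sqrt 2 < x j ∧ x j < (q j).2 + s * Real.sqrt 2}

/-- Closed boxes whose corners have coordinates in the dense set `ℚ + s√2`. -/
def shiftedClosedBox (s : ℕ) (q : ι → ℚ × ℚ) : Set (ι → ℝ) :=
  {x | ∀ j, (q j).1 + s * Real.sqrt 2 ≤ x j ∧ x j ≤ (q j).2 + s * Real.sqrt 2}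

theorem shiftedBox_subset (s : ℕ) (q : ι → ℚ × ℚ) : shiftedBox s q ⊆ shiftedClosedBox s q :=
  fun _ hx j => ⟨(hx j).1.le, (hx j).2.le⟩

theorem isOpen_shiftedBox [Finite ι] (s : ℕ) (q : ι → ℚ × ℚ) : IsOpen (shiftedBox s q) := by
  simp only [shiftedBox, Set.ofPred_forall]
  refine isOpen_iInter_of_finite fun j => ?_
  exact (isOpen_lt continuous_const (continuous_apply j)).inter
    (isOpen_lt (continuous_apply j) continuous_const)

theorem isClosed_shiftedClosedBox (s : ℕ) (q : ι → ℚ × ℚ) : IsClosed (shiftedClosedBox s q) := by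
  simp only [shiftedClosedBox, Set.ofPred_forall]
  refine isClosed_iInter fun j => ?_
  exact (isClosed_le continuous_const (continuous_apply j)).inter
    (isClosed_le (continuous_apply j) continuous_const)

theorem exists_shiftedBox [Fintype ι] (s : ℕ) {A : Set (ι → ℝ)} (hA : IsOpen A) {x : ι → ℝ}
    (hx : x ∈ A) : ∃ q, x ∈ shiftedBox s q ∧ shiftedBox s q ⊆ A := by
  obtain ⟨ε, hε, hball⟩ := Metric.isOpen_iff.1 hA x hx
  have h1 : ∀ j, ∃ q : ℚ, x j - ε / 2 - s * Real.sqrt 2 < q ∧ (q : ℝ) < x j - s * Real.sqrt 2 :=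
    fun j => exists_rat_btwn (by linarith)
  have h2 : ∀ j, ∃ q : ℚ, x j - s * Real.sqrt 2 < q ∧ (q : ℝ) < x j + ε / 2 - s * Real.sqrt 2 :=
    fun j => exists_rat_btwn (by linarith)
  choose a ha using h1
  choose b hb using h2
  refine ⟨fun j => (a j, b j), fun j => ⟨by linarith [(ha j).2], by linarith [(hb j).1]⟩,
    fun y hy => hball ?_⟩
  rw [Metric.mem_ball]
  refine lt_of_le_of_lt ((dist_pi_le_iff (by positivity)).2 fun j => ?_) (half_lt_self hε)
  have h3 := (hy j).1
  have h4 := (hy j).2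
  simp only at h3 h4
  rw [Real.dist_eq, abs_le]
  constructor <;> linarith [(ha j).1, (hb j).2]

theorem rat_add_mul_sqrt_two_inj {q r : ℚ} {s t : ℕ}
    (h : (q : ℝ) + s * Real.sqrt 2 = r + t * Real.sqrt 2) : s = t := by
  by_contra hne
  have hst : (s : ℝ) - t ≠ 0 := sub_ne_zero.2 (by exact_mod_cast hne)
  refine irrational_sqrt_two ⟨(r - q) / ((s : ℚ) - t), ?_⟩
  push_cast
  rw [div_eq_iff hst]
  linarith

/-- For each shift `s = 0, …, n` (`n` the number of coordinates) there is a disjoint family of open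
sets, missing only points with some coordinate in `ℚ + s√2`. These classes are disjoint for
different `s`, so the `n` coordinates of a point cannot spoil all `n + 1` families. -/
theorem coveringDimLE_pi [Fintype ι] : CoveringDimLE (ι → ℝ) (Fintype.card ι) := by
  intro U hUo hUc
  have := Encodable.ofCountable (ι → ℚ × ℚ)
  let T : ℕ → Set (ι → ℚ × ℚ) := fun s => {q | ∃ A ∈ U, shiftedBox s q ⊆ A}
  -- Each box loses the closed boxes enumerated before it; these are finitely many, so the rest is
  -- open.
  let F : ℕ → (ι → ℚ × ℚ) → Set (ι → ℝ) := fun s q =>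
    shiftedBox s q \ ⋃ q' ∈ {q' ∈ T s | Encodable.encode q' < Encodable.encode q},
      shiftedClosedBox s q'
  have hdisj : ∀ s, ∀ q ∈ T s, ∀ q' ∈ T s, ∀ x ∈ F s q, x ∈ F s q' → q = q' := by
    have aux : ∀ s, ∀ q ∈ T s, ∀ q', ∀ x ∈ F s q, x ∈ F s q' →
        ¬ Encodable.encode q < Encodable.encode q' := by
      intro s q hq q' x hx hx' hlt
      exact hx'.2 (Set.mem_biUnion (x := q) ⟨hq, hlt⟩ (shiftedBox_subset s q hx.1))
    intro s q hq q' hq' x hx hx'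
    exact Encodable.encode_injective (le_antisymm (not_lt.1 (aux s q' hq' q x hx' hx))
      (not_lt.1 (aux s q hq q' x hx hx')))
  refine ⟨{B | ∃ s : Fin (Fintype.card ι + 1), ∃ q ∈ T s, B = F s q}, ?_, ?_, ?_, ?_⟩
  · rintro _ ⟨s, q, hq, rfl⟩
    refine (isOpen_shiftedBox _ q).sdiff (Set.Finite.isClosed_biUnion ?_ fun q' _ =>
      isClosed_shiftedClosedBox _ q')
    exact ((Set.finite_lt_nat (Encodable.encode q)).preimage
      Encodable.encode_injective.injOn).subset fun q' hq' => hq'.2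
  · rw [Set.eq_univ_iff_forall]
    intro x
    by_contra hx
    have key : ∀ s : Fin (Fintype.card ι + 1), ∃ j, ∃ r : ℚ, x j = r + (s : ℕ) * Real.sqrt 2 := by
      intro s
      obtain ⟨A, hA, hxA⟩ : x ∈ ⋃₀ U := hUc ▸ Set.mem_univ x
      obtain ⟨q₀, hq₀, hq₀A⟩ := exists_shiftedBox s (hUo A hA) hxA
      -- In the first closed box containing `x`, either `x` is interior, hence covered, or a
      -- coordinate of `x` equals one of a corner.
      obtain ⟨q, ⟨hqT, hxq⟩, hmin⟩ := (measure (Encodable.encode (α := ι → ℚ × ℚ))).wf.has_min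
        {q | q ∈ T s ∧ x ∈ shiftedClosedBox s q}
        ⟨q₀, ⟨A, hA, hq₀A⟩, shiftedBox_subset _ _ hq₀⟩
      by_contra! hne
      refine hx ⟨F s q, ⟨s, q, hqT, rfl⟩, fun j => ?_, ?_⟩
      · exact ⟨lt_of_le_of_ne (hxq j).1 (hne j _).symm, lt_of_le_of_ne (hxq j).2 (hne j _)⟩
      · intro hmem
        obtain ⟨q', ⟨hq'T, hlt⟩, hxq'⟩ := Set.mem_iUnion₂.1 hmem
        exact hmin q' ⟨hq'T, hxq'⟩ hlt
    choose j r hr using key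
    obtain ⟨s, t, hst, hj⟩ := Fintype.exists_ne_map_eq_of_card_lt j (by simp)
    refine hst (Fin.ext (rat_add_mul_sqrt_two_inj (q := r s) (r := r t) ?_))
    rw [← hr s, ← hr t, hj]
  · rintro _ ⟨s, q, ⟨A, hA, hqA⟩, rfl⟩
    exact ⟨A, hA, Set.sdiff_subset.trans hqA⟩
  · intro x
    have hV : ∀ B ∈ {B | (∃ s : Fin (Fintype.card ι + 1), ∃ q ∈ T s, B = F s q) ∧ x ∈ B},
        ∃ s : Fin (Fintype.card ι + 1), ∃ q ∈ T s, B = F s q := fun B hB => hB.1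
    choose! s hs using hV
    refine (Set.encard_le_encard_of_injOn (t := Set.univ) (f := s) (fun _ _ => Set.mem_univ _)
      ?_).trans ?_
    · intro B hB B' hB' e
      obtain ⟨q, hq, h1⟩ := hs B hB
      obtain ⟨q', hq', h2⟩ := hs B' hB'
      have hx := hB.2
      have hx' := hB'.2
      rw [h1] at hx
      rw [h2] at hx'
      rw [h1, h2]
      simp only [← e] at hq' hx' ⊢
      rw [hdisj _ q hq q' hq' x hx hx']
    · rw [Set.encard_univ, ENat.card_eq_coe_fintype_card, Fintype.card_fin]
      simp

theorem CoveringDimLE.of_homeomorph {X Y : Type*} [TopologicalSpace X] [TopologicalSpace Y]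
    (e : X ≃ₜ Y) {d : ℕ} (h : CoveringDimLE X d) : CoveringDimLE Y d := by
  intro U hUo hUc
  obtain ⟨V, hVo, hVc, hVr, hVd⟩ := h ((fun A => e ⁻¹' A) '' U)
    (by rintro _ ⟨A, hA, rfl⟩; exact (hUo A hA).preimage e.continuous)
    (by
      rw [Set.eq_univ_iff_forall]
      intro x
      obtain ⟨A, hA, hx⟩ : e x ∈ ⋃₀ U := hUc ▸ Set.mem_univ _
      exact ⟨_, ⟨A, hA, rfl⟩, hx⟩)
  refine ⟨(fun B => e.symm ⁻¹' B) '' V, ?_, ?_, ?_, fun y => ?_⟩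
  · rintro _ ⟨B, hB, rfl⟩
    exact (hVo B hB).preimage e.symm.continuous
  · rw [Set.eq_univ_iff_forall]
    intro y
    obtain ⟨B, hB, hy⟩ : e.symm y ∈ ⋃₀ V := hVc ▸ Set.mem_univ _
    exact ⟨_, ⟨B, hB, rfl⟩, hy⟩
  · rintro _ ⟨B, hB, rfl⟩
    obtain ⟨_, ⟨A, hA, rfl⟩, hBA⟩ := hVr B hB
    exact ⟨A, hA, fun y hy => by simpa using hBA hy⟩
  · refine le_trans (Set.encard_le_encard ?_)
      ((Set.encard_image_le (fun B => e.symm ⁻¹' B) _).trans (hVd (e.symm y)))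
    rintro _ ⟨⟨B, hB, rfl⟩, hy⟩
    exact ⟨B, ⟨hB, hy⟩, rfl⟩

theorem coveringDimLE_euclideanSpace [Fintype ι] :
    CoveringDimLE (EuclideanSpace ℝ ι) (Fintype.card ι) :=
  coveringDimLE_pi.of_homeomorph
    (PiLp.continuousLinearEquiv 2 ℝ fun _ : ι => ℝ).symm.toHomeomorph

end CoveringDimension

/-! ### The action on Euclidean space. -/

/-- `AffineSignedPerm n` acts on `ℝ^n` by integer translations, coordinate reflections and
coordinate permutations. -/
@[reducible]
noncomputable def affineSignedPermAction (n : ℕ) :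
    MulAction (AffineSignedPerm n) (EuclideanSpace ℝ (ULift.{u} (Fin n))) where
  smul g x := WithLp.toLp 2 fun i =>
    ((g.left i.down).toAdd : ℝ) + ((zmodTwoSign (g.right.left i.down) : ℤˣ) : ℤ) *
      x ⟨g.right.right⁻¹ i.down⟩
  one_smul x := by
    change WithLp.toLp 2 _ = x
    ext i
    simp [Equiv.Perm.one_def]
  mul_smul g h x := by
    change WithLp.toLp 2 _ = WithLp.toLp 2 _
    ext i
    change (((g.left * signedPermHom n g.right h.left) i.down).toAdd : ℝ) +
      ((zmodTwoSign ((g.right.left * mulAutArrow g.right.right h.right.left) i.down) : ℤˣ) : ℤ) *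
      x ⟨(g.right.right * h.right.right)⁻¹ i.down⟩ = ((g.left i.down).toAdd : ℝ) +
      ((zmodTwoSign (g.right.left i.down) : ℤˣ) : ℤ) *
      (((h.left (g.right.right⁻¹ i.down)).toAdd : ℝ) +
        ((zmodTwoSign (h.right.left (g.right.right⁻¹ i.down)) : ℤˣ) : ℤ) *
        x ⟨h.right.right⁻¹ (g.right.right⁻¹ i.down)⟩)
    have h1 : (signedPermHom n g.right h.left) i.down =
        h.left (g.right.right⁻¹ i.down) ^ ((zmodTwoSign (g.right.left i.down) : ℤˣ) : ℤ) := rfl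
    have h2 : (mulAutArrow g.right.right h.right.left) i.down =
        h.right.left (g.right.right⁻¹ i.down) := rfl
    rw [Pi.mul_apply, Pi.mul_apply, h1, h2, toAdd_mul, toAdd_zpow, map_mul, Units.val_mul,
      mul_inv_rev, Equiv.Perm.mul_apply, smul_eq_mul]
    push_cast
    ring

section Action

variable {n : ℕ}

attribute [local instance] affineSignedPermAction

theorem affineSignedPerm_smul_apply (g : AffineSignedPerm n)
    (x : EuclideanSpace ℝ (ULift.{u} (Fin n))) (i : ULift.{u} (Fin n)) :
    (g • x) i = ((g.left i.down).toAdd : ℝ) +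
      ((zmodTwoSign (g.right.left i.down) : ℤˣ) : ℤ) * x ⟨g.right.right⁻¹ i.down⟩ := rfl

theorem isIsometricSMul_affineSignedPerm :
    IsIsometricSMul (AffineSignedPerm n) (EuclideanSpace ℝ (ULift.{u} (Fin n))) := by
  refine ⟨fun g => Isometry.of_dist_eq fun x y => ?_⟩
  rw [EuclideanSpace.dist_eq, EuclideanSpace.dist_eq]
  congr 1
  refine Fintype.sum_equiv ((Equiv.ulift.trans g.right.right⁻¹).trans Equiv.ulift.symm) _ _
    fun i => ?_
  rw [affineSignedPerm_smul_apply, affineSignedPerm_smul_apply, Real.dist_eq,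
    add_sub_add_left_eq_sub, ← mul_sub, abs_mul]
  have : |(((zmodTwoSign (g.right.left i.down) : ℤˣ) : ℤ) : ℝ)| = 1 := by
    rw [← Int.cast_abs, Int.isUnit_iff_abs_eq.1 (Units.isUnit _), Int.cast_one]
  rw [this, one_mul]
  rfl

/-- An element fixing `x` is determined by its linear part, and there are finitely many of those. -/
theorem finite_stabilizer_affineSignedPerm (x : EuclideanSpace ℝ (ULift.{u} (Fin n))) :
    Finite (MulAction.stabilizer (AffineSignedPerm n) x) := by
  have : Finite (SignedPerm n) := Finite.of_equiv _ SemidirectProduct.equivProd.symm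
  refine Finite.of_injective
    (fun g : MulAction.stabilizer (AffineSignedPerm n) x => g.1.right) ?_
  rintro ⟨g, hg⟩ ⟨h, hh⟩ (e : g.right = h.right)
  refine Subtype.ext (SemidirectProduct.ext (funext fun i => ?_) e)
  have h1 := affineSignedPerm_smul_apply g x ⟨i⟩
  have h2 := affineSignedPerm_smul_apply h x ⟨i⟩
  rw [MulAction.mem_stabilizer_iff.1 hg] at h1
  rw [MulAction.mem_stabilizer_iff.1 hh] at h2
  rw [h1, e] at h2
  have : ((g.left i).toAdd : ℝ) = ((h.left i).toAdd : ℝ) := by linarith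
  exact Multiplicative.toAdd.injective (by exact_mod_cast this)

theorem exists_smul_ne (hn : 0 < n) (x : EuclideanSpace ℝ (ULift.{u} (Fin n))) :
    ∃ g : AffineSignedPerm n, g • x ≠ x := by
  refine ⟨SemidirectProduct.inl fun _ => Multiplicative.ofAdd 1, fun h => ?_⟩
  have := affineSignedPerm_smul_apply (SemidirectProduct.inl fun _ => Multiplicative.ofAdd 1)
    x ⟨⟨0, hn⟩⟩
  rw [h] at this
  simp [Equiv.Perm.one_def] at this

end Action

/-! ### The alcove and its wall reflections. -/

section Generators

/-- The reflections in the walls of the alcove `1/2 ≥ x_0 ≥ … ≥ x_m ≥ 0`. -/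
def alcoveReflection (m : ℕ) (j : Fin (m + 2)) : AffineSignedPerm (m + 1) :=
  if (j : ℕ) = 0 then
    -- This is `x_0 ↦ 1 - x_0`; the wall of index `j` is opposite the vertex `alcoveVertex m j`.
    ⟨Pi.mulSingle 0 (Multiplicative.ofAdd 1), ⟨Pi.mulSingle 0 (Multiplicative.ofAdd 1), 1⟩⟩
  else if h : (j : ℕ) < m + 1 then
    SemidirectProduct.inr (SemidirectProduct.inr (Equiv.swap ⟨j - 1, by omega⟩ ⟨j, h⟩))
  else
    SemidirectProduct.inr
      (SemidirectProduct.inl (Pi.mulSingle (Fin.last m) (Multiplicative.ofAdd 1)))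

/-- The vertices of the alcove `1/2 ≥ x_0 ≥ … ≥ x_m ≥ 0`. -/
noncomputable def alcoveVertex (m : ℕ) (k : Fin (m + 2)) :
    EuclideanSpace ℝ (ULift.{0} (Fin (m + 1))) :=
  WithLp.toLp 2 fun i => if (i.down : ℕ) < k then 1 / 2 else 0

attribute [local instance] affineSignedPermAction in
theorem alcoveReflection_smul (m : ℕ) {k j : Fin (m + 2)} (h : k ≠ j) :
    alcoveReflection m j • alcoveVertex m k = alcoveVertex m k := by
  have hv : (k : ℕ) ≠ j := fun e => h (Fin.ext e)
  have hz : (zmodTwoSign (Multiplicative.ofAdd 1) : ℤˣ) = -1 := rfl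
  unfold alcoveReflection
  split_ifs with h0 hj <;> ext ⟨i⟩ <;> rw [affineSignedPerm_smul_apply]
  · by_cases hi : i = 0
    · subst hi
      have : 0 < (k : ℕ) := by omega
      simp [hz, alcoveVertex, this, Equiv.Perm.one_def]
      norm_num
    · simp [Pi.mulSingle_eq_of_ne hi, Equiv.Perm.one_def]
  · have : ((Equiv.swap (⟨j - 1, by omega⟩ : Fin (m + 1)) ⟨j, hj⟩ i : Fin (m + 1)) : ℕ) < k ↔
        (i : ℕ) < k := by
      rw [Equiv.swap_apply_def]
      split_ifs with h1 h2
      · rw [h1]; simp only; omega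
      · rw [h2]; simp only; omega
      · rfl
    simp [alcoveVertex, this]
  · by_cases hi : i = Fin.last m
    · subst hi
      have : ¬ m < (k : ℕ) := by omega
      simp [hz, alcoveVertex, this, Equiv.Perm.one_def]
    · simp [Pi.mulSingle_eq_of_ne hi, Equiv.Perm.one_def]

theorem map_mem_of_mulSingle_mem {ι M G : Type*} [Finite ι] [DecidableEq ι] [CommGroup M] [Group G]
    (f : (ι → M) →* G) (H : Subgroup G) {a : M} (ha : ∀ b : M, b ∈ Subgroup.zpowers a)
    (h : ∀ i, f (Pi.mulSingle i a) ∈ H) (x : ι → M) : f x ∈ H := by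
  have := Fintype.ofFinite ι
  change x ∈ H.comap f
  rw [← Finset.univ_prod_mulSingle x]
  refine Subgroup.prod_mem _ fun i _ => ?_
  obtain ⟨k, hk⟩ := Subgroup.mem_zpowers_iff.1 (ha (x i))
  rw [← hk, ← MonoidHom.mulSingle_apply, map_zpow]
  exact (H.comap f).zpow_mem (h i) k

theorem mulAutArrow_mulSingle {ι M : Type*} [DecidableEq ι] [Monoid M] (σ : Equiv.Perm ι) (i : ι)
    (a : M) : mulAutArrow σ (Pi.mulSingle i a : ι → M) = Pi.mulSingle (σ i) a := by
  funext j
  change (Pi.mulSingle i a : ι → M) (σ⁻¹ j) = _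
  simp only [Pi.mulSingle_apply, Equiv.Perm.inv_eq_iff_eq]

/-- Adjacent transpositions generate `S_n`, whose conjugates of the last sign change give all sign
changes. Multiplying `x_0 ↦ 1 - x_0` by the sign change of `x_0` leaves a unit translation, and
conjugation yields the others. -/
theorem closure_alcoveReflection (m : ℕ) :
    Subgroup.closure (Set.range (alcoveReflection m)) = ⊤ := by
  set H := Subgroup.closure (Set.range (alcoveReflection m)) with hH
  have hmem : ∀ j, alcoveReflection m j ∈ H := fun j => Subgroup.subset_closure ⟨j, rfl⟩
  have hperm : ∀ σ : Equiv.Perm (Fin (m + 1)),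
      (SemidirectProduct.inr (SemidirectProduct.inr σ) : AffineSignedPerm (m + 1)) ∈ H := by
    intro σ
    have hle : Submonoid.closure
        (Set.range fun i : Fin m => Equiv.swap i.castSucc i.succ) ≤
        (H.comap ((SemidirectProduct.inr (φ := signedPermHom (m + 1))).comp
          SemidirectProduct.inr)).toSubmonoid := by
      rw [Submonoid.closure_le]
      rintro _ ⟨i, rfl⟩
      have := hmem i.succ.castSucc
      rw [alcoveReflection, if_neg (by simp), dif_pos (by simp)] at this
      exact this
    rw [Equiv.Perm.mclosure_swap_castSucc_succ] at hle
    exact hle (Submonoid.mem_top σ)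
  have hsign : ∀ e, (SemidirectProduct.inr (SemidirectProduct.inl e) :
      AffineSignedPerm (m + 1)) ∈ H := by
    refine map_mem_of_mulSingle_mem ((SemidirectProduct.inr (φ := signedPermHom (m + 1))).comp
      SemidirectProduct.inl) H (a := Multiplicative.ofAdd 1) ?_ fun i => ?_
    · intro b
      exact Subgroup.mem_zpowers_iff.2 ⟨((Multiplicative.toAdd b).val : ℤ), by
        rw [← ofAdd_zsmul]
        simp⟩
    · have h1 := hmem (Fin.last (m + 1))
      rw [alcoveReflection, if_neg (by simp), dif_neg (by simp)] at h1
      have h2 := H.mul_mem (H.mul_mem (hperm (Equiv.swap (Fin.last m) i)) h1)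
        (H.inv_mem (hperm (Equiv.swap (Fin.last m) i)))
      rw [← map_mul, ← map_inv, ← map_mul, ← map_inv, ← SemidirectProduct.inl_aut,
        mulAutArrow_mulSingle, Equiv.swap_apply_left] at h2
      exact h2
  have htrans : ∀ x, (SemidirectProduct.inl x : AffineSignedPerm (m + 1)) ∈ H := by
    have h0 : (SemidirectProduct.inl (Pi.mulSingle 0 (Multiplicative.ofAdd 1)) :
        AffineSignedPerm (m + 1)) ∈ H := by
      have h1 := hmem 0
      rw [alcoveReflection, if_pos (by simp)] at h1
      rw [← SemidirectProduct.inl_left_mul_inr_right (SemidirectProduct.mk _ _)] at h1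
      exact (H.mul_mem_cancel_right (hsign _)).1 h1
    refine map_mem_of_mulSingle_mem SemidirectProduct.inl H (a := Multiplicative.ofAdd 1)
      ?_ fun i => ?_
    · intro b
      exact Subgroup.mem_zpowers_iff.2 ⟨Multiplicative.toAdd b, by
        rw [← ofAdd_zsmul]
        simp⟩
    · have h2 := H.mul_mem (H.mul_mem (hperm (Equiv.swap 0 i)) h0)
        (H.inv_mem (hperm (Equiv.swap 0 i)))
      rw [← map_inv, ← SemidirectProduct.inl_aut] at h2
      have h3 : signedPermHom (m + 1) (SemidirectProduct.inr (Equiv.swap 0 i))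
          (Pi.mulSingle 0 (Multiplicative.ofAdd 1)) = Pi.mulSingle i (Multiplicative.ofAdd 1) := by
        rw [signedPermHom, SemidirectProduct.lift_inr, mulAutArrow_mulSingle,
          Equiv.swap_apply_left]
      rwa [h3] at h2
  rw [eq_top_iff]
  intro g _
  rw [← SemidirectProduct.inl_left_mul_inr_right g,
    ← SemidirectProduct.inl_left_mul_inr_right g.right, map_mul]
  exact H.mul_mem (htrans _) (H.mul_mem (hsign _) (hperm _))

end Generators

-- The fixed point theorem and its sharpness.

attribute [local instance] affineSignedPermAction in
theorem IsCAT0.exists_fixed_affineSignedPerm {n d : ℕ} (hdn : d < n) {X : Type u} [MetricSpace X]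
    [CompleteSpace X] [MulAction (AffineSignedPerm n) X] [IsIsometricSMul (AffineSignedPerm n) X]
    (h : IsCAT0 X) (hd : CoveringDimLE X d) : ∃ x : X, ∀ g : AffineSignedPerm n, g • x = x := by
  obtain ⟨m, rfl⟩ : ∃ m, n = m + 1 := ⟨n - 1, by omega⟩
  exact h.exists_fixed_of_finite_subgroups hd hdn (alcoveReflection m)
    (closure_alcoveReflection m)
    (fun k => MulAction.stabilizer (AffineSignedPerm (m + 1)) (alcoveVertex m k))
    (fun k => finite_stabilizer_affineSignedPerm _)
    (fun k j hkj => alcoveReflection_smul m hkj)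

theorem not_propertyFA_affineSignedPerm {n : ℕ} (hn : 0 < n) :
    ¬ PropertyFA.{u} (AffineSignedPerm n) n := by
  intro hFA
  let := affineSignedPermAction.{u} n
  have := isIsometricSMul_affineSignedPerm.{u} (n := n)
  have hcat := isCAT0_of_innerProductSpace (EuclideanSpace ℝ (ULift.{u} (Fin n)))
  have hno : ¬ ∃ x : EuclideanSpace ℝ (ULift.{u} (Fin n)),
      ∀ g : AffineSignedPerm n, g • x = x := by
    rintro ⟨x, hx⟩
    obtain ⟨g, hg⟩ := exists_smul_ne hn x
    exact hg (hx g)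
  refine hno (hFA _ hcat ⟨?_, fun k hk => ?_⟩)
  · have := coveringDimLE_euclideanSpace (ι := ULift.{u} (Fin n))
    rwa [Fintype.card_ulift, Fintype.card_fin] at this
  -- The lower bound on the dimension of `ℝ^n`: in a smaller dimension the theorem just proved would
  -- give this action a fixed point.
  · by_contra hlt
    exact hno (hcat.exists_fixed_affineSignedPerm (not_le.1 hlt) hk)

theorem mainTheorem6 (n : ℕ) (hn : 2 ≤ n) :
    PropertyFA.{u} (AffineSignedPerm n) (n - 1) ∧
    (∀ d : ℕ, d < n →
      ∀ (X : Type u) [MetricSpace X] [CompleteSpace X]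
        [MulAction (AffineSignedPerm n) X] [IsIsometricSMul (AffineSignedPerm n) X],
        IsCAT0 X → HasCoveringDim X d → ∃ x : X, ∀ g : AffineSignedPerm n, g • x = x) ∧
    ¬ PropertyFA.{u} (AffineSignedPerm n) n := by
  refine ⟨?_, ?_, not_propertyFA_affineSignedPerm (by omega)⟩
  · intro X _ _ _ _ h hd
    exact h.exists_fixed_affineSignedPerm (by omega) hd.1
  · intro d hdn X _ _ _ _ h hd
    exact h.exists_fixed_affineSignedPerm hdn hd.1
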